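/- A \emph{streaming register transducer} (SRT) over the integers consists of finite sets $\Sigma$ and $\Gamma$ of input and output labels, a finite set $Q$ of states with an initial state $q_0\in Q$, a number $k\in\mathbb N$ of registers with initial values $R_0\in\mathbb Z^k$, and a set of transitions $$\Delta\subseteq Q\times\Sigma\times\{>,=,<\}^k\times\{\mathsf{old},\mathsf{new},\mathsf{add}\}^k\times\{1,\dots,k\}\times\Gamma\times Q .$$ A transition $(q,\sigma,l,m,u,\gamma,q')\in\Delta$ enables, for $d\in\mathbb Z$ and $R,R'\in\mathbb Z^k$, the step from the configuration $(q,R)$ to the configuration $(q',R')$ that reads $(\sigma,d)$ and emits $(\gamma,R'[u])$, provided that for every $i$ the relation $d\; l[i]\; R[i]$ holds, and $R'[i]$ equals $R[i]$, $d$ or $R[i]+d$ according to whether $m[i]$ is $\mathsf{old}$, $\mathsf{new}$ or $\mathsf{add}$. A run over $s\in(\Sigma\times\mathbb Z)^*$ that generates $t\in(\Gamma\times\mathbb Z)^*$, where $|s|=|t|$, is a finite sequence of enabled steps that starts in $(q_0,R_0)$, reads $s$ letter by letter and emits $t$ letter by letter. The SRT is \emph{functional} if for every $s\in(\Sigma\times\mathbb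 Z)^*$ there is at most one $t$ that is generated by a run over $s$. \textbf{Theorem.} It is undecidable whether a given SRT over the integers is functional: no algorithm decides, given a finite description of an SRT over $\mathbb Z$, whether that SRT is functional. -/

import Mathlib

/-! # Streaming register transducers -/

/-- The three possible updates of a register when a letter is read: keep the old value,
store the new data value, or add the new data value. -/
inductive RegUpdate where
  | old
  | new
  | add

/-- A transition of a `k`-register transducer with input labels `A`, output labels `B` and
states `Q`, that is, an element of
`Q × A × {>, =, <}ᵏ × {old, new, add}ᵏ × {1, …, k} × B × Q`. -/
structure SRTTransition (A B Q : Type*) (k : ℕ) where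
  /-- source state -/
  src : Q
  /-- input label -/
  inLabel : A
  /-- comparison of the input data value with each register
  (`Ordering.gt` means that the input value is the larger one) -/
  guard : Fin k → Ordering
  /-- update of each register -/
  upd : Fin k → RegUpdate
  /-- the register whose new value is emitted -/
  outReg : Fin k
  /-- output label -/
  outLabel : B
  /-- target state -/
  dst : Q

/-- A streaming register transducer with (finite) label sets `A` and `B`, data domain `D`,
(finite) state set `Q` and `k` registers. -/
structure SRT (A B D Q : Type*) (k : ℕ) where
  /-- initial state -/
  q₀ : Q
  /-- initial register values -/
  R₀ : Fin k → D
  /-- the set of (nondeterministic) transitions -/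
  Δ : Set (SRTTransition A B Q k)

/-- The value of a register that holds `r`, after an update when the data value `d` is read. -/
def RegUpdate.apply {D : Type*} [Add D] : RegUpdate → D → D → D
  | .old, r, _ => r
  | .new, _, d => d
  | .add, r, d => r + d

/-- A language of finite words over the input-output pairs. (Transformations are the prefix-closed
ones; the language of the runs of a transducer is always prefix-closed.) -/
abbrev Transformation (A B D : Type*) := Set (List ((A × D) × (B × D)))

/-- A transformation is functional if, for every finite input data word `s`, the set of the
words `t` with `|s| = |t|` and `s ⊗ t ∈ T` has at most one element. -/
def Transformation.Functional {A B D : Type*} (T : Transformation A B D) : Prop :=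
  ∀ s : List (A × D), {t : List (B × D) | s.length = t.length ∧ s.zip t ∈ T}.Subsingleton

namespace SRT

variable {A B D Q : Type*} {k : ℕ} [LinearOrder D] [AddGroup D]

/-- The transition step `(q, R) → (q', R')` that reads `a = (σ, d)` and emits `b = (γ, d')`
is enabled by some transition. -/
def Step (S : SRT A B D Q k) (q : Q) (R : Fin k → D) (a : A × D) (b : B × D)
    (q' : Q) (R' : Fin k → D) : Prop :=
  ∃ t ∈ S.Δ, t.src = q ∧ t.inLabel = a.1 ∧ t.dst = q' ∧
    (∀ i, cmp a.2 (R i) = t.guard i) ∧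
    (∀ i, R' i = (t.upd i).apply (R i) a.2) ∧
    b = (t.outLabel, R' t.outReg)

/-- `S.Run q R w q' R'`: a finite sequence of enabled transition steps leads from the
configuration `(q, R)` to `(q', R')`, and `w` is its word of input-output pairs. -/
inductive Run (S : SRT A B D Q k) :
    Q → (Fin k → D) → List ((A × D) × (B × D)) → Q → (Fin k → D) → Prop
  | nil (q : Q) (R : Fin k → D) : Run S q R [] q R
  | cons {q q' q'' : Q} {R R' R'' : Fin k → D} {a : A × D} {b : B × D}
      {w : List ((A × D) × (B × D))} :
      S.Step q R a b q' R' → Run S q' R' w q'' R'' → Run S q R ((a, b) :: w) q'' R''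

/-- The transformation defined by a transducer: the words of all its runs from the initial
configuration. -/
def semantics (S : SRT A B D Q k) : Transformation A B D :=
  {w | ∃ q R, S.Run S.q₀ S.R₀ w q R}

/-- A transducer is functional if the transformation that it defines is. -/
def Functional (S : SRT A B D Q k) : Prop :=
  S.semantics.Functional

end SRT

/-! # Finite descriptions of transducers over the integers

A description is a tuple of natural numbers, integers and lists. The labels and the states
are numbered from `0`, and transitions are listed. -/

/-- `{<, =, >}` has three elements. -/
def orderingEquivFin : Ordering ≃ Fin 3 where
  toFun
    | .lt => 0
    | .eq => 1
    | .gt => 2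
  invFun
    | 0 => .lt
    | 1 => .eq
    | 2 => .gt
  left_inv o := by cases o <;> rfl
  right_inv i := by fin_cases i <;> rfl

/-- `{old, new, add}` has three elements. -/
def regUpdateEquivFin : RegUpdate ≃ Fin 3 where
  toFun
    | .old => 0
    | .new => 1
    | .add => 2
  invFun
    | 0 => .old
    | 1 => .new
    | 2 => .add
  left_inv o := by cases o <;> rfl
  right_inv i := by fin_cases i <;> rfl

instance instPrimcodableOrdering : Primcodable Ordering := Primcodable.ofEquiv _ orderingEquivFin

instance instPrimcodableRegUpdate : Primcodable RegUpdate := Primcodable.ofEquiv _ regUpdateEquivFin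

/-- The description of a transition:
(source, input label, guards, updates, output register, output label, target). -/
abbrev RawTransition := ℕ × ℕ × List Ordering × List RegUpdate × ℕ × ℕ × ℕ

/-- The description of a transition between numbered states. -/
def SRTTransition.raw {a b n k : ℕ} (t : SRTTransition (Fin a) (Fin b) (Fin n) k) :
    RawTransition :=
  (t.src, t.inLabel, List.ofFn t.guard, List.ofFn t.upd, t.outReg, t.outLabel, t.dst)

/-- The raw description of a transducer over the integers:
(number of input labels, number of output labels, number of states, initial state,
initial register values, transitions). -/
abbrev RawSRT := ℕ × ℕ × ℕ × ℕ × List ℤ × List RawTransition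

namespace RawSRT

/-- number of input labels -/
abbrev numIn (c : RawSRT) : ℕ := c.1

/-- number of output labels -/
abbrev numOut (c : RawSRT) : ℕ := c.2.1

/-- number of states -/
abbrev numStates (c : RawSRT) : ℕ := c.2.2.1

/-- number of the initial state -/
abbrev init (c : RawSRT) : ℕ := c.2.2.2.1

/-- list of the initial register values -/
abbrev regs (c : RawSRT) : List ℤ := c.2.2.2.2.1

/-- list of the transitions -/
abbrev trans (c : RawSRT) : List RawTransition := c.2.2.2.2.2

/-- The given sizes of a transducer are respected by a transition description. -/
def TransitionWF (c : RawSRT) (t : RawTransition) : Prop :=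
  t.1 < c.numStates ∧ t.2.1 < c.numIn ∧ t.2.2.1.length = c.regs.length ∧
    t.2.2.2.1.length = c.regs.length ∧ t.2.2.2.2.1 < c.regs.length ∧
    t.2.2.2.2.2.1 < c.numOut ∧ t.2.2.2.2.2.2 < c.numStates

/-- A raw description is well formed if all its numbers and lists are in range. -/
def WF (c : RawSRT) : Prop :=
  c.init < c.numStates ∧ ∀ t ∈ c.trans, c.TransitionWF t

instance instDecidablePredWF : DecidablePred WF := fun c => by
  unfold WF TransitionWF
  infer_instance

theorem primrecPred_wf : PrimrecPred WF := by
  have fst {α β γ : Type} [Primcodable α] [Primcodable β] [Primcodable γ] {f : α → β × γ}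
      (hf : Primrec f) : Primrec fun x => (f x).1 := Primrec.fst.comp hf
  have snd {α β γ : Type} [Primcodable α] [Primcodable β] [Primcodable γ] {f : α → β × γ}
      (hf : Primrec f) : Primrec fun x => (f x).2 := Primrec.snd.comp hf
  have len {α β : Type} [Primcodable α] [Primcodable β] {f : α → List β}
      (hf : Primrec f) : Primrec fun x => (f x).length := Primrec.list_length.comp hf
  have t0 : Primrec fun x : RawTransition × RawSRT => x.1 := Primrec.fst
  have c0 : Primrec fun x : RawTransition × RawSRT => x.2 := Primrec.snd
  have t1 := snd t0
  have t2 := snd t1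
  have t3 := snd t2
  have t4 := snd t3
  have t5 := snd t4
  have c2 := snd (snd c0)
  have k := len (fst (snd (snd c2)))
  have hT : PrimrecRel fun (t : RawTransition) (c : RawSRT) => c.TransitionWF t :=
    (Primrec.nat_lt.comp (fst t0) (fst c2)).and <|
    (Primrec.nat_lt.comp (fst t1) (fst c0)).and <|
    (Primrec.eq.comp (len (fst t2)) k).and <|
    (Primrec.eq.comp (len (fst t3)) k).and <|
    (Primrec.nat_lt.comp (fst t4) k).and <|
    (Primrec.nat_lt.comp (fst t5) (fst (snd c0))).and
    (Primrec.nat_lt.comp (snd t5) (fst c2))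
  have i0 : Primrec fun c : RawSRT => c := Primrec.id
  have i2 := snd (snd i0)
  have i3 := snd i2
  exact (Primrec.nat_lt.comp (fst i3) (fst i2)).and
    (hT.forall_mem_list.comp (snd (snd i3)) i0)

end RawSRT

/-- The well-formed descriptions of transducers over the integers. -/
abbrev SRTCode := {c : RawSRT // c.WF}

instance instPrimcodableSRTCode : Primcodable SRTCode :=
  Primcodable.subtype RawSRT.primrecPred_wf

/-- The transducer over the integers that is described by a well-formed description. -/
def SRTCode.toSRT (c : SRTCode) :
    SRT (Fin c.1.numIn) (Fin c.1.numOut) ℤ (Fin c.1.numStates) c.1.regs.length where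
  q₀ := ⟨c.1.init, c.2.1⟩
  R₀ := c.1.regs.get
  Δ := {t | t.raw ∈ c.1.trans}

/-!
The halting problem reduces to non-functionality.

A transducer can use the value of a register in an addition or in a comparison, because it may read
that value as its next input and enforce this by the guard: reading `d = R i`, it can store `d` in
another register, add `d` to another register, or compare `d` with a further register. Hence the
steps of a while program with assignments `r j := r i`, `r j := r j + r i` and tests `r i ≠ r j` are
transitions of a transducer (`RegProg.Trans`). Its states are the finitely many control states of
the program, that is, lists of programs that remain to be executed (`RegProg.finite_controls`).

The simulation is deterministic: outside the halting state, the input value and the configuration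
determine the output and the next configuration. In the halting state, there is a choice between two
output labels. So the transducer is functional if and only if the program does not terminate
(`RegProg.functional_iff_not_exec`).

While programs compute all primitive recursive functions (`RegProg.exists_computes`), and with one
more loop they search for a zero of such a function (`RegProg.exists_search`). Applied to the
step-bounded evaluator of codes of partial recursive functions, this gives a single program that
terminates exactly on the codes that halt on input `0` (`RegProg.exists_halting`). As the program is
fixed, so are the states and the transitions of the simulating transducer; the code enters only
through one initial register value. The reduction is therefore computable
(`RegProg.exists_primrec_code`).
-/

/-! ### While programs over registers -/

/-- Structured programs over registers that are numbered by `ℕ` and hold natural numbers. -/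
inductive RegProg where
  /-- `copy j i` stores the value of register `i` in register `j`. -/
  | copy (j i : ℕ)
  /-- `add j i` adds the value of register `i` to register `j`. -/
  | add (j i : ℕ)
  /-- sequential composition -/
  | seq (p q : RegProg)
  /-- `whileNe i j p` repeats `p` as long as the registers `i` and `j` differ. -/
  | whileNe (i j : ℕ) (p : RegProg)

namespace RegProg

open Function Relation

/-- Big-step semantics: `Exec p v v'` says that `p`, started with the register contents `v`,
terminates with the contents `v'`. -/
inductive Exec : RegProg → (ℕ → ℕ) → (ℕ → ℕ) → Prop
  | copy (j i : ℕ) (v : ℕ → ℕ) : Exec (copy j i) v (update v j (v i))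
  | add (j i : ℕ) (v : ℕ → ℕ) : Exec (add j i) v (update v j (v j + v i))
  | seq {p q : RegProg} {v v' v'' : ℕ → ℕ} :
      Exec p v v' → Exec q v' v'' → Exec (seq p q) v v''
  | done {i j : ℕ} {v : ℕ → ℕ} (p : RegProg) : v i = v j → Exec (whileNe i j p) v v
  | iter {i j : ℕ} {p : RegProg} {v v' v'' : ℕ → ℕ} : v i ≠ v j → Exec p v v' →
      Exec (whileNe i j p) v' v'' → Exec (whileNe i j p) v v''

theorem Exec.det {p : RegProg} {v v₁ v₂ : ℕ → ℕ} (h₁ : Exec p v v₁) (h₂ : Exec p v v₂) :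
    v₁ = v₂ := by
  induction h₁ generalizing v₂ with
  | copy | add => cases h₂; rfl
  | seq _ _ ih ih' =>
    cases h₂ with
    | seq h h' =>
      cases ih h
      exact ih' h'
  | done _ h =>
    cases h₂ with
    | done => rfl
    | iter h' => exact absurd h h'
  | iter h _ _ ih ih' =>
    cases h₂ with
    | done _ h' => exact absurd h' h
    | iter _ h' h'' =>
      cases ih h'
      exact ih' h''

/-- Small-step semantics. A control state is the list of the programs that remain to be
executed; the empty list is the halting state. -/
inductive Step : List RegProg × (ℕ → ℕ) → List RegProg × (ℕ → ℕ) → Prop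
  | copy (j i : ℕ) (K : List RegProg) (v : ℕ → ℕ) :
      Step (copy j i :: K, v) (K, update v j (v i))
  | add (j i : ℕ) (K : List RegProg) (v : ℕ → ℕ) :
      Step (add j i :: K, v) (K, update v j (v j + v i))
  | seq (p q : RegProg) (K : List RegProg) (v : ℕ → ℕ) :
      Step (seq p q :: K, v) (p :: q :: K, v)
  | done {i j : ℕ} (p : RegProg) (K : List RegProg) {v : ℕ → ℕ} : v i = v j →
      Step (whileNe i j p :: K, v) (K, v)
  | iter {i j : ℕ} (p : RegProg) (K : List RegProg) {v : ℕ → ℕ} : v i ≠ v j →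
      Step (whileNe i j p :: K, v) (p :: whileNe i j p :: K, v)

theorem Exec.reflTransGen {p : RegProg} {v v' : ℕ → ℕ} (h : Exec p v v') (K : List RegProg) :
    ReflTransGen Step (p :: K, v) (K, v') := by
  induction h generalizing K with
  | copy j i v => exact .single (.copy j i K v)
  | add j i v => exact .single (.add j i K v)
  | seq _ _ ih ih' => exact .head (.seq _ _ K _) ((ih _).trans (ih' K))
  | done p h => exact .single (.done p K h)
  | iter h _ _ ih ih' => exact .head (.iter _ K h) ((ih _).trans (ih' K))

/-- Big-step semantics of a list of programs, executed one after the other. -/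
def ExecList : List RegProg → (ℕ → ℕ) → (ℕ → ℕ) → Prop
  | [], v, v' => v = v'
  | p :: K, v, v' => ∃ u, Exec p v u ∧ ExecList K u v'

theorem ExecList.of_reflTransGen {c : List RegProg × (ℕ → ℕ)} {v' : ℕ → ℕ}
    (h : ReflTransGen Step c ([], v')) : ExecList c.1 c.2 v' := by
  induction h using ReflTransGen.head_induction_on with
  | refl => rfl
  | head hs _ ih =>
    cases hs with
    | copy j i K v => exact ⟨_, .copy j i v, ih⟩
    | add j i K v => exact ⟨_, .add j i v, ih⟩
    | seq p q K v =>
      obtain ⟨u, hp, w, hq, hK⟩ := ih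
      exact ⟨w, .seq hp hq, hK⟩
    | done p K h => exact ⟨_, .done p h, ih⟩
    | iter p K h =>
      obtain ⟨u, hp, w, hq, hK⟩ := ih
      exact ⟨w, .iter h hp hq, hK⟩

theorem exec_iff_reflTransGen {p : RegProg} {v v' : ℕ → ℕ} :
    Exec p v v' ↔ ReflTransGen Step ([p], v) ([], v') := by
  refine ⟨fun h => h.reflTransGen [], fun h => ?_⟩
  obtain ⟨u, hu, rfl⟩ := ExecList.of_reflTransGen h
  exact hu

/-- The control states that occur in the execution of `p` followed by `K`, including `K`
itself. -/
def controls : RegProg → List RegProg → Set (List RegProg)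
  | copy j i, K => {copy j i :: K, K}
  | add j i, K => {add j i :: K, K}
  | seq p q, K => {seq p q :: K} ∪ (controls p (q :: K) ∪ controls q K)
  | whileNe i j p, K => {whileNe i j p :: K, K} ∪ controls p (whileNe i j p :: K)

theorem finite_controls (p : RegProg) (K : List RegProg) : (controls p K).Finite := by
  induction p generalizing K <;> simp_all [controls]

theorem cons_mem_controls (p : RegProg) (K : List RegProg) : p :: K ∈ controls p K := by
  cases p <;> simp [controls]

theorem eq_or_mem_controls_of_step {p : RegProg} {K : List RegProg}
    {c c' : List RegProg × (ℕ → ℕ)} (hc : c.1 ∈ controls p K) (h : Step c c') :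
    c.1 = K ∨ c'.1 ∈ controls p K := by
  induction p generalizing K with
  | copy j i | add j i =>
    rcases hc with hc | hc
    · right
      cases h <;> simp_all [controls]
    · exact .inl hc
  | seq p q ihp ihq =>
    rcases hc with hc | hc | hc
    · right
      cases h <;> simp_all [controls, cons_mem_controls]
    · rcases ihp hc with hp | hp
      · rcases ihq (hp ▸ cons_mem_controls q K) with hq | hq
        · exact .inl hq
        · exact .inr (.inr (.inr hq))
      · exact .inr (.inr (.inl hp))
    · rcases ihq hc with hq | hq
      · exact .inl hq
      · exact .inr (.inr (.inr hq))
  | whileNe i j p ih =>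
    have key : c.1 = whileNe i j p :: K → c'.1 ∈ controls (whileNe i j p) K := by
      intro hc
      cases h <;> simp_all [controls, cons_mem_controls]
    rcases hc with (hc | hc) | hc
    · exact .inr (key hc)
    · exact .inl hc
    · rcases ih hc with hp | hp
      · exact .inr (key hp)
      · exact .inr (.inr hp)

theorem mem_controls_of_step {p : RegProg} {c c' : List RegProg × (ℕ → ℕ)}
    (hc : c.1 ∈ controls p []) (h : Step c c') : c'.1 ∈ controls p [] := by
  refine (eq_or_mem_controls_of_step hc h).resolve_left fun h' => ?_
  cases h <;> cases h'

/-! ### Primitive recursive functions are computed by programs -/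

/-- Started with `0` in register `0` and `1` in register `1`, the program `p` writes into register
`z` the value of `f` at the contents of the registers `x i`; the other registers below `b` are
preserved, those from `b` on serve as scratch space. -/
def Computes {n : ℕ} (p : RegProg) (f : List.Vector ℕ n → ℕ) (x : Fin n → ℕ) (z b : ℕ) : Prop :=
  ∀ v : ℕ → ℕ, v 0 = 0 → v 1 = 1 → ∃ v', Exec p v v' ∧
    v' z = f (List.Vector.ofFn fun i => v (x i)) ∧ ∀ j < b, j ≠ z → v' j = v j

/-- Finitely many functions are evaluated one after the other, the `i`-th one into register
`b + i`. -/
theorem exists_computes_all {n m : ℕ} (g : Fin n → List.Vector ℕ m → ℕ) {x : Fin m → ℕ} {b : ℕ}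
    (hb : 2 ≤ b) (hx : ∀ i, x i < b)
    (hg : ∀ i : Fin n, ∃ p, Computes p (g i) x (b + i) (b + n)) (k : ℕ) :
    ∃ p, ∀ v : ℕ → ℕ, v 0 = 0 → v 1 = 1 → ∃ v', Exec p v v' ∧
      (∀ i : Fin n, (i : ℕ) < k → v' (b + i) = g i (List.Vector.ofFn fun i => v (x i))) ∧
      ∀ j < b, v' j = v j := by
  induction k with
  | zero =>
    refine ⟨.copy 0 0, fun v _ _ => ⟨_, .copy 0 0 v, by simp, fun j _ => by simp⟩⟩
  | succ k ih =>
    obtain ⟨p, hp⟩ := ih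
    rcases lt_or_ge k n with hk | hk
    · obtain ⟨q, hq⟩ := hg ⟨k, hk⟩
      refine ⟨.seq p q, fun v h0 h1 => ?_⟩
      obtain ⟨v', he, hv, hf⟩ := hp v h0 h1
      obtain ⟨v'', he', hv', hf'⟩ := hq v' (by rw [hf _ (by omega), h0])
        (by rw [hf _ (by omega), h1])
      refine ⟨v'', .seq he he', fun i hi => ?_, fun j hj => ?_⟩
      · rcases Nat.lt_succ_iff_lt_or_eq.1 hi with hi | hi
        · rw [hf' _ (by omega) (by simp; omega), hv i hi]
        · obtain rfl : i = ⟨k, hk⟩ := Fin.ext hi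
          simpa [hf _ (hx _)] using hv'
      · rw [hf' j (by omega) (by simp; omega), hf j hj]
    · refine ⟨p, fun v h0 h1 => ?_⟩
      obtain ⟨v', he, hv, hf⟩ := hp v h0 h1
      exact ⟨v', he, fun i _ => hv i (by omega), hf⟩

theorem exists_computes {n : ℕ} {f : List.Vector ℕ n → ℕ} (hf : Nat.Primrec' f) :
    ∀ (x : Fin n → ℕ) (z b : ℕ), 2 ≤ z → z < b → (∀ i, x i < b) → ∃ p, Computes p f x z b := by
  induction hf with
  | zero =>
    refine fun x z b hz hb hx => ⟨.copy z 0, fun v h0 h1 => ⟨_, .copy z 0 v, by simp [h0], ?_⟩⟩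
    exact fun j _ hj => update_of_ne hj _ _
  | succ =>
    refine fun x z b hz hb hx => ⟨.seq (.copy z (x 0)) (.add z 1), fun v h0 h1 =>
      ⟨_, .seq (.copy z (x 0) v) (.add z 1 _), ?_, fun j _ hj => ?_⟩⟩
    · have : 1 ≠ z := by omega
      simp [this, h1, List.Vector.ofFn]
    · simp [hj]
  | get i =>
    refine fun x z b hz hb hx => ⟨.copy z (x i), fun v h0 h1 => ⟨_, .copy z (x i) v, by simp, ?_⟩⟩
    exact fun j _ hj => update_of_ne hj _ _
  | @comp m n f g _ _ ihf ihg =>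
    intro x z b hz hb hx
    obtain ⟨p, hp⟩ := exists_computes_all g (b := b) (by omega) hx
      (fun i => ihg i x (b + i) (b + n) (by omega) (by omega)
        fun j => (hx j).trans_le (by omega)) n
    obtain ⟨q, hq⟩ := ihf (fun i => b + i) z (b + n) hz (by omega) fun i => by omega
    refine ⟨.seq p q, fun v h0 h1 => ?_⟩
    obtain ⟨v', he, hv, hf⟩ := hp v h0 h1
    obtain ⟨v'', he', hv', hf'⟩ := hq v' (by rw [hf _ (by omega), h0])
      (by rw [hf _ (by omega), h1])
    refine ⟨v'', .seq he he', ?_, fun j hj hjz => ?_⟩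
    · simp [hv', hv]
    · rw [hf' j (by omega) hjz, hf j hj]
  | @prec n f g _ _ ihf ihg =>
    -- register `b` is the loop counter, register `b + 1` the accumulator
    intro x z b hz hb hx
    obtain ⟨p, hp⟩ := ihf (fun i => x i.succ) (b + 1) (b + 2) (by omega) (by omega)
      fun i => (hx _).trans_le (by omega)
    obtain ⟨q, hq⟩ := ihg (Fin.cons b (Fin.cons (b + 1) fun i => x i.succ)) (b + 1) (b + 2)
      (by omega) (by omega) (by
        refine Fin.cases (by simp) (Fin.cases (by simp) fun i => ?_)
        simpa using (hx i.succ).trans_le (by omega))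
    refine ⟨.seq (.copy b 0) (.seq p (.seq (.whileNe b (x 0) (.seq q (.add b 1)))
      (.copy z (b + 1)))), fun v h0 h1 => ?_⟩
    set xs := List.Vector.ofFn fun i => v (x i) with hxs
    have hhead : xs.head = v (x 0) := by simp [hxs, List.Vector.ofFn]
    have htail : xs.tail = List.Vector.ofFn fun i : Fin n => v (x i.succ) := by
      simp [hxs, List.Vector.ofFn]
    have hloop : ∀ (d : ℕ) (u : ℕ → ℕ), (∀ j < b, u j = v j) → u b + d = xs.head →
        u (b + 1) = (u b).rec (f xs.tail) (fun y IH => g (y ::ᵥ IH ::ᵥ xs.tail)) →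
        ∃ u', Exec (.whileNe b (x 0) (.seq q (.add b 1))) u u' ∧ (∀ j < b, u' j = v j) ∧
          u' (b + 1) = xs.head.rec (f xs.tail) (fun y IH => g (y ::ᵥ IH ::ᵥ xs.tail)) := by
      intro d
      induction d with
      | zero =>
        intro u hu hd ha
        rw [add_zero] at hd
        exact ⟨u, .done _ (by rw [hd, hu _ (hx 0), hhead]), hu, by rw [ha, hd]⟩
      | succ d ih =>
        intro u hu hd ha
        obtain ⟨u', he, hv, hf⟩ := hq u (by rw [hu _ (by omega), h0]) (by rw [hu _ (by omega), h1])
        have hb' : u' b = u b := hf b (by omega) (by omega)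
        have h1' : u' 1 = 1 := by rw [hf 1 (by omega) (by omega), hu _ (by omega), h1]
        obtain ⟨w, hw, hw', hw''⟩ := ih (update u' b (u' b + u' 1))
          (fun j hj => by
            rw [update_of_ne (by omega), hf j (by omega) (by omega), hu j hj])
          (by rw [update_self, hb', h1']; omega)
          (by
            rw [update_self, update_of_ne (by omega), hv, hb', h1']
            simp [List.Vector.ofFn, ha, htail, hu _ (hx _)])
        refine ⟨w, .iter ?_ (.seq he (.add b 1 u')) hw, hw', hw''⟩
        rw [hu _ (hx 0), ← hhead]
        omega
    have hc : ∀ j < b, update v b (v 0) j = v j := fun j hj => update_of_ne (by omega) _ _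
    obtain ⟨u, he, hv, hf⟩ := hp (update v b (v 0)) (by rw [hc _ (by omega), h0])
      (by rw [hc _ (by omega), h1])
    have hub : u b = 0 := by rw [hf b (by omega) (by omega), update_self, h0]
    have hu : ∀ j < b, u j = v j := fun j hj => by
      rw [hf j (by omega) (by omega), hc j hj]
    obtain ⟨w, hw, hw', hw''⟩ := hloop xs.head u hu (by omega) (by
      rw [hv, hub]
      simp [htail, hc _ (hx _)])
    refine ⟨_, .seq (.copy b 0 v) (.seq he (.seq hw (.copy z (b + 1) w))), ?_, fun j hj hjz => ?_⟩
    · rw [update_self, hw'']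
    · rw [update_of_ne hjz, hw' j hj]

/-! ### Unbounded search -/

/-- Register contents with the constants `0` and `1` in registers `0` and `1`, the input `m` in
register `2`, and `0` in all other registers. -/
def initMem (m : ℕ) : ℕ → ℕ
  | 1 => 1
  | 2 => m
  | _ => 0

/-- For a primitive recursive function `h`, there is a program that, on input `m`, terminates if and
only if `h` has a zero of the form `(k, m)`. -/
theorem exists_search {h : List.Vector ℕ 2 → ℕ} (hh : Nat.Primrec' h) :
    ∃ p, ∀ m, (∃ v, Exec p (initMem m) v) ↔ ∃ k, h (k ::ᵥ m ::ᵥ .nil) = 0 := by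
  -- register `3` holds the candidate `k`, register `4` the value of `h`
  obtain ⟨p, hp⟩ := exists_computes hh ![3, 2] 4 5 (by omega) (by omega)
    (by intro i; fin_cases i <;> simp)
  refine ⟨.seq p (.whileNe 4 0 (.seq (.add 3 1) p)), fun m => ?_⟩
  let Inv (v : ℕ → ℕ) : Prop :=
    v 0 = 0 ∧ v 1 = 1 ∧ v 2 = m ∧ v 4 = h (v 3 ::ᵥ m ::ᵥ .nil)
  have hrun : ∀ v : ℕ → ℕ, v 0 = 0 → v 1 = 1 → v 2 = m →
      ∃ v', Exec p v v' ∧ Inv v' ∧ v' 3 = v 3 := by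
    intro v h0 h1 h2
    obtain ⟨v', he, hv, hf⟩ := hp v h0 h1
    have h3 : v' 3 = v 3 := hf 3 (by omega) (by omega)
    refine ⟨v', he, ⟨by rw [hf 0 (by omega) (by omega), h0], by rw [hf 1 (by omega) (by omega), h1],
      by rw [hf 2 (by omega) (by omega), h2], ?_⟩, h3⟩
    rw [hv, h3]
    simp [List.Vector.ofFn, h2]
  have hbody : ∀ v, Inv v → ∃ v', Exec (.seq (.add 3 1) p) v v' ∧ Inv v' ∧ v' 3 = v 3 + 1 := by
    rintro v ⟨h0, h1, h2, -⟩
    obtain ⟨v', he, hi, h3⟩ := hrun (update v 3 (v 3 + v 1)) (by simp [h0]) (by simp [h1])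
      (by simp [h2])
    exact ⟨v', .seq (.add 3 1 v) he, hi, by simp [h3, h1]⟩
  obtain ⟨v₀, he₀, hi₀, h3₀⟩ := hrun (initMem m) rfl rfl rfl
  constructor
  · rintro ⟨v, hv⟩
    cases hv with
    | seq he hw =>
      cases he.det he₀
      clear he₀ he h3₀
      generalize hq : RegProg.whileNe 4 0 (.seq (.add 3 1) p) = q at hw
      induction hw with
      | copy | add | seq => cases hq
      | done _ hd =>
        cases hq
        exact ⟨_, by rw [← hi₀.2.2.2, hd, hi₀.1]⟩
      | iter _ he _ _ ih =>
        cases hq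
        obtain ⟨v', he', hi', -⟩ := hbody _ hi₀
        cases he.det he'
        exact ih hi' rfl
  · rintro ⟨k, hk⟩
    have hloop : ∀ (d : ℕ) (v : ℕ → ℕ), Inv v → v 3 + d = k →
        ∃ v', Exec (.whileNe 4 0 (.seq (.add 3 1) p)) v v' := by
      intro d
      induction d with
      | zero =>
        intro v hv hd
        rw [add_zero] at hd
        exact ⟨v, .done _ (by rw [hv.2.2.2, hd, hk, hv.1])⟩
      | succ d ih =>
        intro v hv hd
        by_cases hz : v 4 = v 0
        · exact ⟨v, .done _ hz⟩
        · obtain ⟨v', he, hi, h3⟩ := hbody v hv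
          obtain ⟨w, hw⟩ := ih v' hi (by omega)
          exact ⟨w, .iter hz he hw⟩
    obtain ⟨w, hw⟩ := hloop k v₀ hi₀ (by rw [h3₀]; simp [initMem])
    exact ⟨w, .seq he₀ hw⟩

end RegProg

/-! ### Transducers that simulate programs -/

namespace RegProg

open Function Relation

/-- A bound on the registers that are read by the first step of a program. -/
def readBound : RegProg → ℕ
  | copy _ i => i + 1
  | add _ i => i + 1
  | seq _ _ => 0
  | whileNe i j _ => max i j + 1

/-- `Trans k s g u s'` is the transition with guard `g` and updates `u` by which a transducer with
`k` registers makes a step of a program from the control state `s` to `s'`. To use the value of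
register `i`, the transducer reads it as the input value, which it enforces by the guard. In the
halting control state, it reads any values and changes nothing. -/
inductive Trans (k : ℕ) :
    List RegProg → (Fin k → Ordering) → (Fin k → RegUpdate) → List RegProg → Prop
  | copy (j : ℕ) (i : Fin k) (K : List RegProg) (g : Fin k → Ordering) : g i = .eq →
      Trans k (copy j i :: K) g (fun l => if (l : ℕ) = j then .new else .old) K
  | add (j : ℕ) (i : Fin k) (K : List RegProg) (g : Fin k → Ordering) : g i = .eq →
      Trans k (add j i :: K) g (fun l => if (l : ℕ) = j then .add else .old) K
  | seq (p q : RegProg) (K : List RegProg) (g : Fin k → Ordering) :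
      Trans k (seq p q :: K) g (fun _ => .old) (p :: q :: K)
  | done (i j : Fin k) (p : RegProg) (K : List RegProg) (g : Fin k → Ordering) :
      g i = .eq → g j = .eq → Trans k (whileNe i j p :: K) g (fun _ => .old) K
  | iter (i j : Fin k) (p : RegProg) (K : List RegProg) (g : Fin k → Ordering) :
      g i = .eq → g j ≠ .eq →
      Trans k (whileNe i j p :: K) g (fun _ => .old) (p :: whileNe i j p :: K)
  | halt (g : Fin k → Ordering) : Trans k [] g (fun _ => .old) []

theorem Trans.det {k : ℕ} {s s₁ s₂ : List RegProg} {g : Fin k → Ordering}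
    {u₁ u₂ : Fin k → RegUpdate} (h₁ : Trans k s g u₁ s₁) (h₂ : Trans k s g u₂ s₂) :
    u₁ = u₂ ∧ s₁ = s₂ := by
  generalize hs : s = s' at h₂
  cases h₁ <;> cases h₂ <;> simp_all [Fin.val_inj]

/-- The register contents of the transducer that represent the memory `v` of a program. -/
def regs (k : ℕ) (v : ℕ → ℕ) : Fin k → ℤ := fun l => v l

theorem exists_trans_of_step {k : ℕ} {c c' : List RegProg × (ℕ → ℕ)} (h : Step c c')
    (hk : ∀ p ∈ c.1, p.readBound ≤ k) :
    ∃ (d : ℤ) (u : Fin k → RegUpdate), Trans k c.1 (fun l => cmp d (regs k c.2 l)) u c'.1 ∧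
      ∀ l, regs k c'.2 l = (u l).apply (regs k c.2 l) d := by
  cases h with
  | copy j i K v =>
    have hi : i < k := hk (.copy j i) (by simp)
    refine ⟨v i, _, .copy j ⟨i, hi⟩ K _ (by simp [regs]), fun l => ?_⟩
    by_cases hl : (l : ℕ) = j <;> simp [regs, RegUpdate.apply, hl]
  | add j i K v =>
    have hi : i < k := hk (.add j i) (by simp)
    refine ⟨v i, _, .add j ⟨i, hi⟩ K _ (by simp [regs]), fun l => ?_⟩
    by_cases hl : (l : ℕ) = j <;> simp [regs, RegUpdate.apply, hl]
  | seq p q K v => exact ⟨0, _, .seq p q K _, fun l => rfl⟩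
  | @done i j p K v h =>
    have hij : max i j < k := hk (.whileNe i j p) (by simp)
    exact ⟨v i, _, .done ⟨i, by omega⟩ ⟨j, by omega⟩ p K _ (by simp [regs]) (by simp [regs, h]),
      fun l => rfl⟩
  | @iter i j p K v h =>
    have hij : max i j < k := hk (.whileNe i j p) (by simp)
    exact ⟨v i, _, .iter ⟨i, by omega⟩ ⟨j, by omega⟩ p K _ (by simp [regs])
      (by simpa [regs] using h), fun l => rfl⟩

theorem Trans.exists_step {k : ℕ} {s s' : List RegProg} {v : ℕ → ℕ} {d : ℤ}
    {u : Fin k → RegUpdate} (h : Trans k s (fun l => cmp d (regs k v l)) u s') (hs : s ≠ []) :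
    ∃ v', Step (s, v) (s', v') ∧ ∀ l, regs k v' l = (u l).apply (regs k v l) d := by
  generalize hg : (fun l => cmp d (regs k v l)) = g at h
  cases h with
  | copy j i K _ h =>
    obtain rfl : d = v i := by simpa [← hg, regs] using h
    refine ⟨_, .copy j i s' v, fun l => ?_⟩
    by_cases hl : (l : ℕ) = j <;> simp [regs, RegUpdate.apply, hl]
  | add j i K _ h =>
    obtain rfl : d = v i := by simpa [← hg, regs] using h
    refine ⟨_, .add j i s' v, fun l => ?_⟩
    by_cases hl : (l : ℕ) = j <;> simp [regs, RegUpdate.apply, hl]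
  | seq p q K => exact ⟨v, .seq p q K v, fun l => rfl⟩
  | done i j p K _ h h' =>
    obtain rfl : d = v i := by simpa [← hg, regs] using h
    exact ⟨v, .done p s' (by simpa [← hg, regs] using h'), fun l => rfl⟩
  | iter i j p K _ h h' =>
    obtain rfl : d = v i := by simpa [← hg, regs] using h
    exact ⟨v, .iter p K (by simpa [← hg, regs] using h'), fun l => rfl⟩
  | halt => exact absurd rfl hs

/-- The transitions of the transducer with `k` registers that simulates a program, where `ctrl`
lists the control states. Every transition emits the content of register `0`, with the label `0`
except in the halting state, where the labels `0` and `1` are both possible. -/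
def transitions {n : ℕ} (ctrl : Fin n → List RegProg) (k : ℕ) :
    Set (SRTTransition (Fin 1) (Fin 2) (Fin n) k) :=
  {t | Trans k (ctrl t.src) t.guard t.upd (ctrl t.dst) ∧ (t.outReg : ℕ) = 0 ∧
    (ctrl t.src ≠ [] → t.outLabel = 0)}

end RegProg

namespace SRT

theorem Run.append {A B D Q : Type*} {k : ℕ} [LinearOrder D] [AddGroup D] {S : SRT A B D Q k}
    {q q' q'' : Q} {R R' R'' : Fin k → D} {w w' : List ((A × D) × (B × D))}
    (h : S.Run q R w q' R') (h' : S.Run q' R' w' q'' R'') : S.Run q R (w ++ w') q'' R'' := by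
  induction h with
  | nil => exact h'
  | cons hs _ ih => exact .cons hs (ih h')

/-- A transducer is functional if and only if the word of a run is determined by its projection to
the input. -/
theorem functional_iff {A B D Q : Type*} {k : ℕ} [LinearOrder D] [AddGroup D]
    {S : SRT A B D Q k} :
    S.Functional ↔ ∀ w ∈ S.semantics, ∀ w' ∈ S.semantics,
      w.map Prod.fst = w'.map Prod.fst → w = w' := by
  constructor
  · intro h w hw w' hw' hww'
    have h1 := List.zip_of_prod rfl rfl (xs := w)
    have h2 := List.zip_of_prod hww'.symm rfl (xs := w')
    have h3 := congrArg List.length hww'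
    rw [List.length_map, List.length_map] at h3
    have := h (w.map Prod.fst) (x := w.map Prod.snd) ⟨by simp, by rwa [← h1]⟩
      (y := w'.map Prod.snd) ⟨by simpa using h3, by rwa [← h2]⟩
    rw [h1, h2, this]
  · rintro h s t ⟨hl, ht⟩ t' ⟨hl', ht'⟩
    have := h _ ht _ ht' (by rw [List.map_fst_zip hl.le, List.map_fst_zip hl'.le])
    rw [← List.map_snd_zip hl.ge, this, List.map_snd_zip hl'.ge]

end SRT

namespace RegProg

open Function Relation

section Simulation

variable {n k : ℕ} {ctrl : Fin n → List RegProg} {S : SRT (Fin 1) (Fin 2) ℤ (Fin n) k}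

theorem exists_run_of_reflTransGen (hS : S.Δ = transitions ctrl k) (hk : 0 < k)
    (hb : ∀ q, ∀ p ∈ ctrl q, p.readBound ≤ k)
    (hc : ∀ q v c, Step (ctrl q, v) c → ∃ q', ctrl q' = c.1)
    {c c' : List RegProg × (ℕ → ℕ)} (h : ReflTransGen Step c c') (q : Fin n) (hq : ctrl q = c.1) :
    ∃ w q', ctrl q' = c'.1 ∧ S.Run q (regs k c.2) w q' (regs k c'.2) := by
  induction h using ReflTransGen.head_induction_on generalizing q with
  | refl => exact ⟨[], q, hq, .nil _ _⟩
  | @head c c₁ hs _ ih =>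
    obtain ⟨q₁, hq₁⟩ := hc q c.2 c₁ (hq ▸ hs)
    obtain ⟨w, q', hq', hw⟩ := ih q₁ hq₁
    obtain ⟨d, u, ht, hu⟩ := exists_trans_of_step hs (hq ▸ hb q)
    rw [← hq, ← hq₁] at ht
    refine ⟨_, q', hq', .cons (a := (0, d)) ⟨⟨q, 0, _, u, ⟨0, hk⟩, 0, q₁⟩, ?_, rfl, rfl, rfl,
      fun _ => rfl, hu, rfl⟩ hw⟩
    rw [hS]
    exact ⟨ht, rfl, fun _ => rfl⟩

theorem not_functional_of_run (hS : S.Δ = transitions ctrl k) (hk : 0 < k)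
    {w : List ((Fin 1 × ℤ) × (Fin 2 × ℤ))} {q : Fin n} {R : Fin k → ℤ} (hq : ctrl q = [])
    (h : S.Run S.q₀ S.R₀ w q R) : ¬ S.Functional := by
  have hstep : ∀ o : Fin 2, S.Step q R (0, 0) (o, R ⟨0, hk⟩) q R := fun o =>
    ⟨⟨q, 0, fun i => cmp 0 (R i), fun _ => .old, ⟨0, hk⟩, o, q⟩, by
      rw [hS]
      exact ⟨by simpa only [hq] using .halt _, rfl, fun h => absurd hq h⟩,
      rfl, rfl, rfl, fun _ => rfl, fun _ => rfl, rfl⟩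
  have hmem : ∀ o : Fin 2, w ++ [((0, 0), (o, R ⟨0, hk⟩))] ∈ S.semantics := fun o =>
    ⟨q, R, h.append (.cons (hstep o) (.nil _ _))⟩
  intro hf
  simpa using SRT.functional_iff.1 hf _ (hmem 0) _ (hmem 1) (by simp)

/-- As long as the halting state is out of reach, the word of a run is determined by its input:
the guard is determined by the input value and the registers, and the transition by the guard. -/
theorem eq_of_run (hS : S.Δ = transitions ctrl k) (hinj : Injective ctrl)
    {w w' : List ((Fin 1 × ℤ) × (Fin 2 × ℤ))} {q q₁ q₂ : Fin n} {R₁ R₂ : Fin k → ℤ} {v : ℕ → ℕ}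
    (hv : ∀ v', ¬ ReflTransGen Step (ctrl q, v) ([], v'))
    (h : S.Run q (regs k v) w q₁ R₁) (h' : S.Run q (regs k v) w' q₂ R₂)
    (hw : w.map Prod.fst = w'.map Prod.fst) : w = w' := by
  generalize hR : regs k v = R at h
  induction h generalizing v w' with
  | nil => exact (List.map_eq_nil_iff.1 hw.symm).symm
  | @cons q q' _ R R' _ a b w hs _ ih =>
    subst hR
    cases h' with
    | nil => simp at hw
    | @cons _ q'' _ _ R'' _ a' b' w' hs' hr =>
      simp only [List.map_cons, List.cons.injEq] at hw
      obtain ⟨rfl, hw⟩ := hw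
      have hq : ctrl q ≠ [] := fun h => hv v (h ▸ .refl)
      obtain ⟨t, ht, rfl, -, rfl, hg, hu, rfl⟩ := hs
      obtain ⟨t', ht', hsrc, -, rfl, hg', hu', rfl⟩ := hs'
      rw [hS] at ht ht'
      obtain ⟨h1, h2, h3⟩ := ht
      obtain ⟨h1', h2', h3'⟩ := ht'
      rw [← funext hg] at h1
      rw [← funext hg', hsrc] at h1'
      obtain ⟨hupd, hdst⟩ := h1.det h1'
      have hdst := hinj hdst
      obtain ⟨v', hstep, hv'⟩ := h1.exists_step hq
      obtain rfl : R' = regs k v' := funext fun l => by rw [hu, hv']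
      obtain rfl : R'' = regs k v' := funext fun l => by rw [hu', hv', hupd]
      rw [h3 hq, h3' (hsrc ▸ hq), Fin.ext (h2.trans h2'.symm)]
      rw [← hdst] at hr
      rw [ih (fun u hu => hv u (.head hstep hu)) hr hw rfl]

/-- The two output labels in the halting state are the only source of non-functionality. -/
theorem functional_iff_not_exec (hS : S.Δ = transitions ctrl k) (hk : 0 < k)
    (hinj : Injective ctrl) {p : RegProg} (hp : Set.range ctrl = controls p [])
    (hb : ∀ q, ∀ p ∈ ctrl q, p.readBound ≤ k) {v : ℕ → ℕ} (h₀ : ctrl S.q₀ = [p])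
    (hR : S.R₀ = regs k v) : S.Functional ↔ ¬ ∃ v', Exec p v v' := by
  simp only [exec_iff_reflTransGen]
  constructor
  · rintro h ⟨v', hv'⟩
    obtain ⟨w, q, hq, hw⟩ := exists_run_of_reflTransGen hS hk hb
      (fun q u c hs => hp.ge (mem_controls_of_step (hp.le ⟨q, rfl⟩) hs)) hv' S.q₀ h₀
    exact not_functional_of_run hS hk hq (by rwa [hR]) h
  · rw [SRT.functional_iff]
    rintro h w ⟨q, R, hw⟩ w' ⟨q', R', hw'⟩ hww'
    rw [hR] at hw hw'
    exact eq_of_run hS hinj (fun v' hv' => h ⟨v', h₀ ▸ hv'⟩) hw hw' hww'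

end Simulation

end RegProg

/-! ### Descriptions of the simulating transducers -/

theorem SRTTransition.raw_injective {a b n k : ℕ} :
    Function.Injective (SRTTransition.raw : SRTTransition (Fin a) (Fin b) (Fin n) k → _) := by
  rintro ⟨⟩ ⟨⟩ h
  simp only [raw, Prod.mk.injEq, Fin.val_inj, List.ofFn_inj] at h
  simpa using h

instance RegUpdate.instFinite : Finite RegUpdate := .of_equiv _ regUpdateEquivFin.symm

instance SRTTransition.instFinite {A B Q : Type*} [Finite A] [Finite B] [Finite Q] {k : ℕ} :
    Finite (SRTTransition A B Q k) :=
  have : Finite Ordering := .of_equiv _ orderingEquivFin.symm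
  .of_injective
    (fun t => (t.src, t.inLabel, t.guard, t.upd, t.outReg, t.outLabel, t.dst)) <| by
      rintro ⟨⟩ ⟨⟩ h
      simpa using h

namespace SRTCode

/-- The descriptions of the transitions in `Δ`, in some order. -/
noncomputable def rawList {a b n k : ℕ} (Δ : Set (SRTTransition (Fin a) (Fin b) (Fin n) k)) :
    List RawTransition :=
  Δ.toFinite.toFinset.toList.map SRTTransition.raw

theorem mem_rawList {a b n k : ℕ} {Δ : Set (SRTTransition (Fin a) (Fin b) (Fin n) k)}
    {r : RawTransition} : r ∈ rawList Δ ↔ ∃ t ∈ Δ, t.raw = r := by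
  simp [rawList]

/-- The description of the transducer with the transitions `Δ`, the initial state `q` and the
initial register values `L`. The number of registers is, definitionally, the length of `L`. -/
noncomputable def ofTransitions {a b n : ℕ} (L : List ℤ)
    (Δ : Set (SRTTransition (Fin a) (Fin b) (Fin n) L.length)) (q : Fin n) : SRTCode :=
  ⟨(a, b, n, q, L, rawList Δ), q.2, fun r hr => by
    obtain ⟨t, -, rfl⟩ := mem_rawList.1 hr
    simp [RawSRT.TransitionWF, SRTTransition.raw]⟩

theorem toSRT_ofTransitions {a b n : ℕ} (L : List ℤ)
    (Δ : Set (SRTTransition (Fin a) (Fin b) (Fin n) L.length)) (q : Fin n) :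
    (ofTransitions L Δ q).toSRT = ⟨q, L.get, Δ⟩ := by
  have : {t : SRTTransition (Fin a) (Fin b) (Fin n) L.length | t.raw ∈ rawList Δ} = Δ := by
    ext t
    simp only [Set.mem_ofPred_eq, mem_rawList]
    exact ⟨fun ⟨t', ht, h⟩ => SRTTransition.raw_injective h ▸ ht, fun h => ⟨t, h, rfl⟩⟩
  exact congrArg (SRT.mk (D := ℤ) q L.get) this

end SRTCode

theorem Primrec.int_natCast : Primrec (fun m : ℕ => (m : ℤ)) := by
  have h : ∀ m : ℕ, Denumerable.ofNat ℤ (2 * m) = m := fun m => by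
    rw [← Denumerable.ofNat_encode (m : ℤ)]
    congr 1
  exact ((Primrec.ofNat ℤ).comp (Primrec.nat_mul.comp (.const 2) .id)).of_eq h

namespace RegProg

/-- The register contents `initMem m`, as a list of length `N + 3`. -/
def initRegs (N m : ℕ) : List ℤ := 0 :: 1 :: (m : ℤ) :: List.replicate N 0

theorem length_initRegs (N m : ℕ) : (initRegs N m).length = N + 3 := by simp [initRegs]

theorem get_initRegs (N m : ℕ) : (initRegs N m).get = regs _ (initMem m) := by
  funext ⟨l, hl⟩
  match l with
  | 0 => rfl
  | 1 => rfl
  | 2 => rfl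
  | l + 3 => simp [initRegs, regs, initMem]

/-- Termination of a program reduces to non-functionality. Only the initial register values of the
transducer depend on the input of the program. -/
theorem exists_primrec_code (p : RegProg) :
    ∃ F : ℕ → SRTCode, Primrec F ∧
      ∀ m, (F m).toSRT.Functional ↔ ¬ ∃ v, Exec p (initMem m) v := by
  obtain ⟨n, ctrl, hinj, hrange⟩ : ∃ (n : ℕ) (ctrl : Fin n → List RegProg),
      Function.Injective ctrl ∧ Set.range ctrl = controls p [] := by
    obtain ⟨n, e, h⟩ := (finite_controls p []).fin_embedding
    exact ⟨n, e, e.injective, h⟩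
  obtain ⟨q₀, hq₀⟩ : ∃ q, ctrl q = [p] := hrange.ge (cons_mem_controls p [])
  obtain ⟨N, hN⟩ : ∃ N, ∀ q, ∀ p ∈ ctrl q, p.readBound ≤ N := by
    refine ⟨Finset.univ.sup fun q => ((ctrl q).map readBound).sum, fun q p hp => ?_⟩
    exact (List.le_sum_of_mem (List.mem_map_of_mem hp)).trans
      (Finset.le_sup (f := fun q => ((ctrl q).map readBound).sum) (Finset.mem_univ q))
  refine ⟨fun m => .ofTransitions (initRegs N m) (transitions ctrl _) q₀, ?_, fun m => ?_⟩
  · refine Primrec.subtype_val_iff.1 ?_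
    have h : Primrec fun m : ℕ => ((1, 2, n, q₀, initRegs N m,
        SRTCode.rawList (transitions ctrl (N + 3))) : RawSRT) :=
      .pair (.const _) <| .pair (.const _) <| .pair (.const _) <| .pair (.const _) <|
        .pair (Primrec.list_cons.comp (.const _) <| Primrec.list_cons.comp (.const _) <|
          Primrec.list_cons.comp Primrec.int_natCast (.const _)) (.const _)
    refine h.of_eq fun m => ?_
    simp only [SRTCode.ofTransitions]
    rw [length_initRegs]
  · rw [SRTCode.toSRT_ofTransitions]
    have hk := length_initRegs N m
    exact functional_iff_not_exec (k := (initRegs N m).length) rfl (by omega) hinj hrange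
      (fun q p hp => (hN q p hp).trans (by omega)) hq₀ (get_initRegs N m)

end RegProg

open Nat.Partrec in
/-- A program that terminates exactly on the numbers of the codes that halt on input `0`: it
searches for a number of steps that suffices. -/
theorem RegProg.exists_halting :
    ∃ p : RegProg, ∀ c : Code, (∃ v, Exec p (initMem (Encodable.encode c)) v) ↔ (c.eval 0).Dom := by
  let h : List.Vector ℕ 2 → ℕ := fun a =>
    bif (Code.evaln (a.get 0) (Denumerable.ofNat Code (a.get 1)) 0).isSome then 0 else 1
  have hh : Primrec h :=
    Primrec.cond (Primrec.option_isSome.comp (Code.primrec_evaln.comp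
      (((Primrec.vector_get.comp .id (.const 0)).pair
        ((Primrec.ofNat Code).comp (Primrec.vector_get.comp .id (.const 1)))).pair (.const 0))))
      (.const 0) (.const 1)
  obtain ⟨p, hp⟩ := exists_search (Nat.Primrec'.of_prim hh)
  refine ⟨p, fun c => (hp _).trans ?_⟩
  have hk : ∀ k, h (k ::ᵥ Encodable.encode c ::ᵥ .nil) = 0 ↔ (Code.evaln k c 0).isSome := by
    intro k
    have : h (k ::ᵥ Encodable.encode c ::ᵥ .nil) =
        bif (Code.evaln k (Denumerable.ofNat Code (Encodable.encode c)) 0).isSome then 0 else 1 :=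
      rfl
    rw [this, Denumerable.ofNat_encode]
    cases (Code.evaln k c 0).isSome <;> simp
  simp only [hk, Option.isSome_iff_exists, Part.dom_iff_mem, Code.evaln_complete, Option.mem_def]
  exact exists_comm

/-- No algorithm decides, given a finite description of a streaming register transducer over
the integers, whether the transducer is functional. -/
theorem mainTheorem3 :
    ¬ ComputablePred (fun c : SRTCode => c.toSRT.Functional) := by
  intro hdec
  obtain ⟨p, hp⟩ := RegProg.exists_halting
  obtain ⟨F, hF, hFp⟩ := p.exists_primrec_code
  refine ComputablePred.halting_problem 0 ?_
  have hred : (fun c : Nat.Partrec.Code => ¬ (c.eval 0).Dom) ≤₀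
      fun c : SRTCode => c.toSRT.Functional :=
    ⟨fun c => F (Encodable.encode c), (hF.comp Primrec.encode).to_comp,
      fun c => ((hFp _).trans (hp c).not).symm⟩
  simpa using (ComputablePred.computable_of_manyOneReducible hred hdec).not
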